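/- Let $H$ be a complex Hilbert space with norm $|\cdot|$ and inner product $(\cdot\,|\,\cdot)$ (linear in the first variable), and let $A$ be an operator in $H$ with domain $D(A)$ such that $-A$ is the infinitesimal generator of a strongly continuous semigroup $e^{-tA}$, $t\ge0$, of bounded operators on $H$ that is holomorphic, i.e. it extends to a semigroup $e^{-zA}$ that is holomorphic in an open sector $\{z\ne0 : |\arg z|<\delta\}$ for some $\delta\in\,]0,\frac\pi2[$ and strongly continuous at $z=0$ in this sector. Suppose that $A$ is positively accretive, i.e. $\operatorname{Re}(Ax\,|\,x)>0$ for every $x\in D(A)$ with $|x|=1$, and hyponormal, i.e. $A$ is densely defined, $D(A)\subset D(A^*)$ and $|Ax|\ge|A^*x|$ for all $x\in D(A)$. Let $m(A)=\inf\{\operatorname{Re}(Ax\,|\,x) : x\in D(A),\ |x|=1\}$. Then: (i) For every $x\in D(A^2)$ with $|x|=1$, $$2\big(\operatorname{Re}(Ax\,|\,x)\big)^2\le \operatorname{Re}(A^2x\,|\,x)+|Ax|^2 .$$ (ii) For every $u_0\in H$ with $u_0\ne0$, the height function $h(t)=|e^{-tA}u_0|$ is log-convex on $[0,\infty[$, that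 is, whenever $0\le r<s<t$, $$|e^{-sA}u_0|\le |e^{-rA}u_0|^{\frac{t-s}{t-r}}\,|e^{-tA}u_0|^{\frac{s-r}{t-r}} .$$ Moreover, for every $u_0\ne0$, the function $h$ is strictly decreasing and strictly convex on $[0,\infty[$, it belongs to $C^\infty(]0,\infty[,\mathbb R)$, and it is differentiable from the right at $t=0$ in the extended sense, with a derivative $h'(0)\in[-\infty,0]$ given by $h'(0)=\inf_{t>0}h'(t)$; if $|u_0|=1$, then $h'(0)\le -m(A)$. Finally, if $u_0\in D(A)$ and $|u_0|=1$, then $h'(0)=-\operatorname{Re}(Au_0\,|\,u_0)$ and $h\in C^1([0,\infty[,\mathbb R)\cap C^\infty(]0,\infty[,\mathbb R)$. -/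

import Mathlib

open Filter Topology
open scoped ContDiff

noncomputable section

namespace HolSemigroup

variable {H : Type*} [NormedAddCommGroup H] [InnerProductSpace ℂ H]

/-- The open sector of all nonzero `z` with `-δ < arg z < δ`. -/
def sector (δ : ℝ) : Set ℂ :=
  {z | z ≠ 0 ∧ -δ < Complex.arg z ∧ Complex.arg z < δ}

/-- `T` is a holomorphic (analytic) semigroup of bounded operators on the open sector of
half-angle `δ` together with the origin. The values of `T` elsewhere are irrelevant. No uniform
boundedness is required. -/
structure IsHolomorphicSemigroup (δ : ℝ) (T : ℂ → H →L[ℂ] H) : Prop where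
  angle_pos : 0 < δ
  angle_lt : δ < Real.pi / 2
  map_zero : T 0 = ContinuousLinearMap.id ℂ H
  map_add : ∀ z ∈ sector δ, ∀ w ∈ sector δ, T (z + w) = (T z).comp (T w)
  differentiableOn : DifferentiableOn ℂ T (sector δ)
  tendsto_zero : ∀ x : H, Tendsto (fun z => T z x) (𝓝[sector δ] 0) (𝓝 x)

/-- `B` is the infinitesimal generator of `(T t)` for `t ≥ 0`: a vector `x` is in the domain of
`B` exactly if the difference quotients `(T t x - x) / t` converge for `t → 0⁺`, and then the
limit is `B x`. -/
def IsGenerator (B : H →ₗ.[ℂ] H) (T : ℂ → H →L[ℂ] H) : Prop :=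
  ∀ x y : H, (∃ hx : x ∈ B.domain, B ⟨x, hx⟩ = y) ↔
    Tendsto (fun t : ℝ => ((t⁻¹ : ℝ) : ℂ) • (T (t : ℂ) x - x)) (𝓝[>] 0) (𝓝 y)

/-- The numerical range of an unbounded operator. (Mathlib's inner product is linear in the
second variable.) -/
def numericalRange (A : H →ₗ.[ℂ] H) : Set ℂ :=
  {z | ∃ x : A.domain, ‖(x : H)‖ = 1 ∧ inner ℂ (x : H) (A x) = z}

/-- The lower bound `m(A)`, the infimum of the real parts of the numerical range, as an
extended real number. -/
def lowerBound (A : H →ₗ.[ℂ] H) : EReal :=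
  ⨅ z ∈ numericalRange A, ((z.re : ℝ) : EReal)

/-- The numerical range is contained in the open right half-plane. -/
def IsPositivelyAccretive (A : H →ₗ.[ℂ] H) : Prop :=
  numericalRange A ⊆ {z : ℂ | 0 < z.re}

/-- `A` is densely defined, `D(A) ⊆ D(A*)`, and `|A* x| ≤ |A x|` for `x` in `D(A)`. -/
structure IsHyponormal [CompleteSpace H] (A : H →ₗ.[ℂ] H) : Prop where
  dense_domain : Dense (A.domain : Set H)
  domain_le : A.domain ≤ A.adjoint.domain
  norm_adjoint_le : ∀ (x : H) (hx : x ∈ A.domain),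
    ‖A.adjoint ⟨x, domain_le hx⟩‖ ≤ ‖A ⟨x, hx⟩‖

/-- `2 (Re ⟨A x, x⟩)² ≤ Re ⟨A² x, x⟩ + |A x|²` for all unit vectors `x` in `D(A²)`, that is, for
`x` in `D(A)` with `A x` in `D(A)`. -/
def LogConvexityCriterion (A : H →ₗ.[ℂ] H) : Prop :=
  ∀ (x : H) (hx : x ∈ A.domain) (hAx : A ⟨x, hx⟩ ∈ A.domain), ‖x‖ = 1 →
    2 * (inner ℂ x (A ⟨x, hx⟩)).re ^ 2 ≤
      (inner ℂ x (A ⟨A ⟨x, hx⟩, hAx⟩)).re + ‖A ⟨x, hx⟩‖ ^ 2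

/-- The height function `h(t) = |T(t) u₀|`, to be considered for `t ≥ 0`. -/
def height (T : ℂ → H →L[ℂ] H) (u₀ : H) : ℝ → ℝ :=
  fun t => ‖T (t : ℂ) u₀‖

/-- Log-convexity on the closed half-line `[0, ∞)` of a nonnegative function. -/
def IsLogConvex (f : ℝ → ℝ) : Prop :=
  ∀ r s t : ℝ, 0 ≤ r → r < s → s < t →
    f s ≤ f r ^ ((t - s) / (t - r)) * f t ^ ((s - r) / (t - r))

/-- `f` is differentiable from the right at `0` in the extended sense, with derivative `d`. -/
def HasExtendedRightDerivAtZero (f : ℝ → ℝ) (d : EReal) : Prop :=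
  Tendsto (fun t : ℝ => (((f t - f 0) / t : ℝ) : EReal)) (𝓝[>] 0) (𝓝 d)

end HolSemigroup

end

/-! Write `u t = T t u₀` and `h = ‖u‖`. Where `u` does not vanish, the second derivative of `log h`
is `((Re ⟨u, u''⟩ + ‖u'‖²) ‖u‖² - 2 (Re ⟨u, u'⟩)²) / ‖u‖⁴`. Holomorphy puts `u t` in `D(A²)` for `t
> 0`, with `u' = -A u` and `u'' = A² u`, so nonnegativity of this quantity is exactly the
homogeneous form of the criterion (i). Hyponormality gives (i) by Cauchy–Schwarz applied to `x` and
`A* x + A x`.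

Analyticity also gives backward uniqueness, so `h > 0` and `log h` is defined and smooth for
positive times. Accretivity makes `h' < 0`. Strict convexity follows because `h` is the strictly
convex `exp` composed with the convex, injective function `log h`. Convexity then makes the
difference quotients at `0` monotone, which yields the extended derivative. -/

namespace HolSemigroup

/-! ### Convex functions on the half-line -/

section Convexity

/-- The difference quotient at `0` of a convex function on `[0, ∞)` that is differentiable on
`(0, ∞)` converges in the extended reals to the infimum of the derivative. -/
theorem hasExtendedRightDerivAtZero_iInf_deriv {f : ℝ → ℝ} (hf : ConvexOn ℝ (Set.Ici 0) f)
    (hc : ContinuousOn f (Set.Ici 0)) (hd : ∀ t, 0 < t → DifferentiableAt ℝ f t) :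
    HasExtendedRightDerivAtZero f (⨅ t : Set.Ioi (0 : ℝ), ((deriv f t : ℝ) : EReal)) := by
  have hmono : MonotoneOn (fun t : ℝ => (((f t - f 0) / t : ℝ) : EReal)) (Set.Ioi 0) := by
    intro s hs t ht hst
    have := hf.secant_mono (a := 0) (x := s) (y := t) (by simp) (Set.mem_Ici.2 (le_of_lt hs))
      (Set.mem_Ici.2 (le_of_lt ht)) (ne_of_gt hs) (ne_of_gt ht) hst
    simp only [sub_zero] at this
    exact EReal.coe_le_coe_iff.2 this
  have hlim := hmono.tendsto_nhdsGT (OrderBot.bddBelow _)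
  unfold HasExtendedRightDerivAtZero
  convert hlim using 2
  -- The limit of the monotone quotients is their infimum. Each quotient is a value of the
  -- derivative by the mean value theorem, and by convexity is at most the derivative at its right
  -- endpoint.
  apply le_antisymm
  · refine le_sInf ?_
    rintro _ ⟨t, ht, rfl⟩
    obtain ⟨c, hct, hc'⟩ := exists_deriv_eq_slope f (Set.mem_Ioi.1 ht)
      (hc.mono Set.Icc_subset_Ici_self)
      (fun x hx => (hd x hx.1).differentiableWithinAt)
    refine (iInf_le _ (⟨c, hct.1⟩ : Set.Ioi (0 : ℝ))).trans ?_
    simp only [hc', sub_zero, le_refl]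
  · refine le_iInf fun ⟨t, ht⟩ => (sInf_le (Set.mem_image_of_mem _ ht)).trans ?_
    have := hf.slope_le_deriv (x := 0) (y := t) (by simp) (Set.mem_Ici.2 (le_of_lt ht)) ht (hd t ht)
    rw [slope_def_field, sub_zero] at this
    exact_mod_cast this

/-- A positive function with convex logarithm is log-convex. -/
theorem isLogConvex_of_convexOn_log {f : ℝ → ℝ} (hpos : ∀ t, 0 ≤ t → 0 < f t)
    (hf : ConvexOn ℝ (Set.Ici 0) fun t => Real.log (f t)) : IsLogConvex f := by
  intro r s t hr hrs hst
  have hs : 0 ≤ s := hr.trans hrs.le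
  have ht : 0 ≤ t := hs.trans hst.le
  have hrt : 0 < t - r := by linarith
  have key := hf.2 (Set.mem_Ici.2 hr) (Set.mem_Ici.2 ht)
    (div_nonneg (by linarith : 0 ≤ t - s) hrt.le) (div_nonneg (by linarith : 0 ≤ s - r) hrt.le)
    (by field_simp; ring)
  have e : (t - s) / (t - r) * r + (s - r) / (t - r) * t = s := by field_simp; ring
  simp only [smul_eq_mul, e] at key
  rw [Real.rpow_def_of_pos (hpos r hr), Real.rpow_def_of_pos (hpos t ht), ← Real.exp_add,
    ← Real.log_le_iff_le_exp (hpos s hs)]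
  linarith

/-- A positive injective function with convex logarithm is strictly convex. -/
theorem strictConvexOn_of_convexOn_log {s : Set ℝ} {f : ℝ → ℝ} (hpos : ∀ t ∈ s, 0 < f t)
    (hinj : Set.InjOn f s) (hf : ConvexOn ℝ s fun t => Real.log (f t)) :
    StrictConvexOn ℝ s f := by
  refine ⟨hf.1, fun x hx y hy hxy a b ha hb hab => ?_⟩
  have hz := hf.1 hx hy ha.le hb.le hab
  have h1 := (Real.log_le_iff_le_exp (hpos _ hz)).1 (hf.2 hx hy ha.le hb.le hab)
  have hne : Real.log (f x) ≠ Real.log (f y) := fun h =>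
    hxy (hinj hx hy (Real.log_injOn_pos (hpos x hx) (hpos y hy) h))
  have h2 := strictConvexOn_exp.2 (Set.mem_univ _) (Set.mem_univ _) hne ha hb hab
  rw [Real.exp_log (hpos x hx), Real.exp_log (hpos y hy)] at h2
  exact h1.trans_lt h2

end Convexity

variable {H : Type*} [NormedAddCommGroup H] [InnerProductSpace ℂ H]

/-! ### Norms of curves in Hilbert space -/

section Curves

theorem re_inner_self (x : H) : (inner ℂ x x).re = ‖x‖ ^ 2 :=
  (norm_sq_eq_re_inner (𝕜 := ℂ) x).symm

theorem _root_.HasDerivWithinAt.norm_of_ne_zero {u : ℝ → H} {u' : H} {s : Set ℝ} {t : ℝ}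
    (hu : HasDerivWithinAt u u' s t) (h0 : u t ≠ 0) :
    HasDerivWithinAt (fun t => ‖u t‖) ((inner ℂ (u t) u').re / ‖u t‖) s t := by
  have h1 : HasDerivWithinAt (fun t => (inner ℂ (u t) (u t)).re)
      ((inner ℂ (u t) u').re + (inner ℂ u' (u t)).re) s t :=
    Complex.reCLM.hasFDerivAt.comp_hasDerivWithinAt t (hu.inner ℂ hu)
  have h2 : HasDerivWithinAt (fun t => ‖u t‖ ^ 2) (2 * (inner ℂ (u t) u').re) s t := by
    have e : (inner ℂ u' (u t)).re = (inner ℂ (u t) u').re := inner_re_symm (𝕜 := ℂ) u' (u t)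
    rw [e, ← two_mul] at h1
    simpa only [re_inner_self] using h1
  have h3 := h2.sqrt (by positivity)
  simp only [Real.sqrt_sq (norm_nonneg _)] at h3
  convert h3 using 1
  field_simp

theorem _root_.HasDerivAt.re_inner {u v : ℝ → H} {u' v' : H} {t : ℝ}
    (hu : HasDerivAt u u' t) (hv : HasDerivAt v v' t) :
    HasDerivAt (fun t => (inner ℂ (u t) (v t)).re)
      ((inner ℂ (u t) v').re + (inner ℂ u' (v t)).re) t := by
  exact Complex.reCLM.hasFDerivAt.comp_hasDerivAt t (hu.inner ℂ hv)

/-- The logarithm of the norm of a curve is convex if the curve satisfies the second order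
differential inequality that expresses nonnegativity of the second derivative. -/
theorem convexOn_log_norm {u u' u'' : ℝ → H} (hc : ContinuousOn u (Set.Ici 0))
    (h0 : ∀ t, 0 ≤ t → u t ≠ 0) (hu : ∀ t, 0 < t → HasDerivAt u (u' t) t)
    (hu' : ∀ t, 0 < t → HasDerivAt u' (u'' t) t)
    (h : ∀ t, 0 < t → 2 * (inner ℂ (u t) (u' t)).re ^ 2 ≤
      ((inner ℂ (u t) (u'' t)).re + ‖u' t‖ ^ 2) * ‖u t‖ ^ 2) :
    ConvexOn ℝ (Set.Ici 0) fun t => Real.log ‖u t‖ := by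
  have hn : ∀ t, 0 < t → HasDerivAt (fun t => ‖u t‖) ((inner ℂ (u t) (u' t)).re / ‖u t‖) t := by
    intro t ht
    rw [← hasDerivWithinAt_univ]
    exact (hu t ht).hasDerivWithinAt.norm_of_ne_zero (h0 t ht.le)
  refine convexOn_of_hasDerivWithinAt2_nonneg (convex_Ici 0)
    (f' := fun t => (inner ℂ (u t) (u' t)).re / ‖u t‖ / ‖u t‖)
    (f'' := fun t => ((((inner ℂ (u t) (u'' t)).re + (inner ℂ (u' t) (u' t)).re) * ‖u t‖ -
      (inner ℂ (u t) (u' t)).re * ((inner ℂ (u t) (u' t)).re / ‖u t‖)) / ‖u t‖ ^ 2 * ‖u t‖ -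
      (inner ℂ (u t) (u' t)).re / ‖u t‖ * ((inner ℂ (u t) (u' t)).re / ‖u t‖)) / ‖u t‖ ^ 2)
    (hc.norm.log fun t ht => norm_ne_zero_iff.2 (h0 t ht)) ?_ ?_ ?_
  all_goals
    rw [interior_Ici]
    intro t ht
    have ht : 0 < t := ht
    have hne := norm_ne_zero_iff.2 (h0 t ht.le)
  · exact ((hn t ht).log hne).hasDerivWithinAt
  · exact ((((hu t ht).re_inner (hu' t ht)).div (hn t ht) hne).div (hn t ht) hne).hasDerivWithinAt
  · rw [re_inner_self]
    have hk := h t ht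
    have hp : 0 < ‖u t‖ := norm_pos_iff.2 (h0 t ht.le)
    refine div_nonneg ?_ (by positivity)
    have e : ∀ a b c : ℝ, (a * c - b * (b / c)) / c ^ 2 * c - b / c * (b / c) =
        (a * c ^ 2 - 2 * b ^ 2) / c ^ 2 := fun a b c => by
      rcases eq_or_ne c 0 with rfl | hc
      · simp
      · field_simp
        ring
    rw [e]
    exact div_nonneg (by linarith) (by positivity)

end Curves

/-! ### Hyponormality and the numerical range -/

section Operator

variable [CompleteSpace H] {A : H →ₗ.[ℂ] H}

/-- With `y = A x` and `w = A* x`, `2 Re ⟨x, y⟩ = Re ⟨x, w + y⟩ ≤ ‖w + y‖`. Squaring, the cross term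
is `Re ⟨w, y⟩ = Re ⟨x, A² x⟩`, and `‖w‖ ≤ ‖y‖` absorbs the rest. -/
theorem IsHyponormal.logConvexityCriterion (hA : IsHyponormal A) : LogConvexityCriterion A := by
  intro x hx hAx hx1
  set y := A ⟨x, hx⟩ with hy
  set w := A.adjoint ⟨x, hA.domain_le hx⟩ with hw
  have hadj := LinearPMap.adjoint_isFormalAdjoint hA.dense_domain
  have h1 : inner ℂ w x = inner ℂ x y := hadj ⟨x, hA.domain_le hx⟩ ⟨x, hx⟩
  have h2 : inner ℂ w y = inner ℂ x (A ⟨y, hAx⟩) := hadj ⟨x, hA.domain_le hx⟩ ⟨y, hAx⟩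
  have h3 : ‖w‖ ≤ ‖y‖ := hA.norm_adjoint_le x hx
  have h4 : (inner ℂ x w).re = (inner ℂ x y).re := by
    rw [← h1]; exact inner_re_symm (𝕜 := ℂ) x w
  have h5 : ‖w + y‖ ^ 2 = ‖w‖ ^ 2 + 2 * (inner ℂ w y).re + ‖y‖ ^ 2 :=
    norm_add_sq (𝕜 := ℂ) w y
  have h6 : |(inner ℂ x (w + y)).re| ≤ ‖w + y‖ := by
    refine (Complex.abs_re_le_norm _).trans ((norm_inner_le_norm _ _).trans ?_)
    rw [hx1, one_mul]
  rw [inner_add_right, Complex.add_re, h4] at h6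
  have h7 := pow_le_pow_left₀ (abs_nonneg _) h6 2
  rw [sq_abs, h5] at h7
  have h8 : ‖w‖ ^ 2 ≤ ‖y‖ ^ 2 := by gcongr
  rw [← h2]
  linear_combination (h7 + h8) / 2

end Operator

theorem LogConvexityCriterion.smul_norm {A : H →ₗ.[ℂ] H} (hA : LogConvexityCriterion A)
    {x : H} (hx : x ∈ A.domain) (hAx : A ⟨x, hx⟩ ∈ A.domain) :
    2 * (inner ℂ x (A ⟨x, hx⟩)).re ^ 2 ≤
      ((inner ℂ x (A ⟨A ⟨x, hx⟩, hAx⟩)).re + ‖A ⟨x, hx⟩‖ ^ 2) * ‖x‖ ^ 2 := by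
  rcases eq_or_ne x 0 with rfl | h0
  · simp
  have hp : 0 < ‖x‖ := norm_pos_iff.2 h0
  set c : ℂ := ((‖x‖⁻¹ : ℝ) : ℂ) with hc
  have e1 : A ⟨c • x, A.domain.smul_mem c hx⟩ = c • A ⟨x, hx⟩ := A.map_smul c ⟨x, hx⟩
  have m : A ⟨c • x, A.domain.smul_mem c hx⟩ ∈ A.domain := by
    rw [e1]; exact A.domain.smul_mem c hAx
  have e2 : A ⟨_, m⟩ = c • A ⟨A ⟨x, hx⟩, hAx⟩ := by
    rw [← A.map_smul c ⟨A ⟨x, hx⟩, hAx⟩]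
    congr 1
    exact Subtype.ext e1
  have key := hA (c • x) (A.domain.smul_mem c hx) m (by
    rw [norm_smul, hc, Complex.norm_real, norm_inv, norm_norm, inv_mul_cancel₀ hp.ne'])
  rw [e2, e1] at key
  simp only [inner_smul_left, inner_smul_right, norm_smul, hc, Complex.conj_ofReal,
    Complex.re_ofReal_mul, Complex.norm_real, norm_inv, norm_norm] at key
  have e3 : 2 * (inner ℂ x (A ⟨x, hx⟩)).re ^ 2 =
      (2 * (‖x‖⁻¹ * (‖x‖⁻¹ * (inner ℂ x (A ⟨x, hx⟩)).re)) ^ 2) * ‖x‖ ^ 4 := by field_simp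
  rw [e3]
  refine (mul_le_mul_of_nonneg_right key (by positivity)).trans_eq ?_
  field_simp

theorem exists_mem_numericalRange {A : H →ₗ.[ℂ] H} {x : H} (hx : x ∈ A.domain) (h0 : x ≠ 0) :
    ∃ z ∈ numericalRange A, (inner ℂ x (A ⟨x, hx⟩)).re = z.re * ‖x‖ ^ 2 := by
  have hp : 0 < ‖x‖ := norm_pos_iff.2 h0
  set c : ℂ := ((‖x‖⁻¹ : ℝ) : ℂ) with hc
  refine ⟨_, ⟨c • ⟨x, hx⟩, ?_, rfl⟩, ?_⟩
  · rw [Submodule.coe_smul, norm_smul, hc, Complex.norm_real, norm_inv, norm_norm,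
      inv_mul_cancel₀ hp.ne']
  · rw [A.map_smul, Submodule.coe_smul]
    simp only [inner_smul_left, inner_smul_right, hc, Complex.conj_ofReal, Complex.re_ofReal_mul]
    field_simp

theorem IsPositivelyAccretive.re_inner_pos {A : H →ₗ.[ℂ] H} (hA : IsPositivelyAccretive A)
    {x : H} (hx : x ∈ A.domain) (h0 : x ≠ 0) : 0 < (inner ℂ x (A ⟨x, hx⟩)).re := by
  obtain ⟨z, hz, e⟩ := exists_mem_numericalRange hx h0
  have : 0 < z.re := hA hz
  have hp : 0 < ‖x‖ := norm_pos_iff.2 h0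
  rw [e]
  positivity

theorem lowerBound_mul_sq_le {A : H →ₗ.[ℂ] H} {x : H} (hx : x ∈ A.domain) (h0 : x ≠ 0) {m : ℝ}
    (hm : (m : EReal) ≤ lowerBound A) : m * ‖x‖ ^ 2 ≤ (inner ℂ x (A ⟨x, hx⟩)).re := by
  obtain ⟨z, hz, e⟩ := exists_mem_numericalRange hx h0
  have : m ≤ z.re := by exact_mod_cast hm.trans (iInf₂_le z hz)
  rw [e]
  gcongr

/-! ### Regularity and nonvanishing of orbits -/

theorem isOpen_sector {δ : ℝ} (hδ : δ < Real.pi / 2) : IsOpen (sector δ) := by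
  rw [isOpen_iff_mem_nhds]
  rintro z ⟨h0, h1, h2⟩
  have hs : z ∈ Complex.slitPlane :=
    Complex.mem_slitPlane_iff_arg.2 ⟨by linarith [Real.pi_pos], h0⟩
  have hc := Complex.continuousAt_arg hs
  filter_upwards [isOpen_ne.mem_nhds h0, hc.eventually (lt_mem_nhds h1),
    hc.eventually (gt_mem_nhds h2)] with w w0 w1 w2
  exact ⟨w0, w1, w2⟩

theorem ofReal_mem_sector {δ t : ℝ} (hδ : 0 < δ) (ht : 0 < t) : (t : ℂ) ∈ sector δ := by
  refine ⟨by exact_mod_cast ht.ne', ?_, ?_⟩ <;> rw [Complex.arg_ofReal_of_nonneg ht.le] <;>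
    linarith

namespace IsHolomorphicSemigroup

variable {δ : ℝ} {T : ℂ → H →L[ℂ] H} (hT : IsHolomorphicSemigroup δ T)
include hT

theorem apply_add {s t : ℝ} (hs : 0 ≤ s) (ht : 0 ≤ t) (x : H) :
    T ((s + t : ℝ) : ℂ) x = T (s : ℂ) (T (t : ℂ) x) := by
  rcases hs.eq_or_lt with rfl | hs
  · simp [hT.map_zero]
  rcases ht.eq_or_lt with rfl | ht
  · simp [hT.map_zero]
  rw [Complex.ofReal_add, hT.map_add _ (ofReal_mem_sector hT.angle_pos hs) _
    (ofReal_mem_sector hT.angle_pos ht)]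
  rfl

theorem tendsto_nhdsGT (x : H) : Tendsto (fun t : ℝ => T (t : ℂ) x) (𝓝[>] 0) (𝓝 x) := by
  refine (hT.tendsto_zero x).comp (tendsto_nhdsWithin_iff.2 ⟨?_, ?_⟩)
  · exact (Complex.continuous_ofReal.tendsto' 0 0 Complex.ofReal_zero).mono_left
      nhdsWithin_le_nhds
  · filter_upwards [self_mem_nhdsWithin] with t ht using ofReal_mem_sector hT.angle_pos ht

variable [CompleteSpace H]

theorem analyticAt (x : H) {t : ℝ} (ht : 0 < t) :
    AnalyticAt ℝ (fun t : ℝ => T (t : ℂ) x) t := by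
  have h1 : AnalyticAt ℂ T (t : ℂ) := hT.differentiableOn.analyticAt
    ((isOpen_sector hT.angle_lt).mem_nhds (ofReal_mem_sector hT.angle_pos ht))
  have h2 : AnalyticAt ℂ (fun z => T z x) (t : ℂ) :=
    ((ContinuousLinearMap.apply ℂ H x).analyticAt _).comp h1
  exact (h2.restrictScalars (𝕜 := ℝ)).comp_of_eq (Complex.ofRealCLM.analyticAt t) rfl

theorem continuousOn (x : H) : ContinuousOn (fun t : ℝ => T (t : ℂ) x) (Set.Ici 0) := by
  intro t ht
  rcases (Set.mem_Ici.1 ht).eq_or_lt with rfl | ht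
  · rw [← continuousWithinAt_Ioi_iff_Ici]
    simpa [ContinuousWithinAt, hT.map_zero] using hT.tendsto_nhdsGT x
  · exact (hT.analyticAt x ht).continuousAt.continuousWithinAt

/-- Backward uniqueness of orbits. -/
theorem apply_ne_zero {x : H} (hx : x ≠ 0) {t : ℝ} (ht : 0 ≤ t) : T (t : ℂ) x ≠ 0 := by
  intro h
  have hz : ∀ s, t ≤ s → T (s : ℂ) x = 0 := fun s hs => by
    rw [← sub_add_cancel s t, hT.apply_add (sub_nonneg.2 hs) ht, h, _root_.map_zero]
  -- The point `t + 1` is interior to the zero set and positive even when `t = 0`; the identity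
  -- theorem then kills the orbit on all of `(0, ∞)`, contradicting its limit `x ≠ 0` at `0`.
  have hev : (fun s : ℝ => T (s : ℂ) x) =ᶠ[𝓝 (t + 1)] 0 := by
    filter_upwards [lt_mem_nhds (lt_add_one t)] with s hs using hz s hs.le
  have han : AnalyticOnNhd ℝ (fun s : ℝ => T (s : ℂ) x) (Set.Ioi 0) :=
    fun s hs => hT.analyticAt x hs
  have h0 := han.eqOn_zero_of_preconnected_of_eventuallyEq_zero isPreconnected_Ioi
    (Set.mem_Ioi.2 (by linarith)) hev
  refine hx (tendsto_nhds_unique_of_eventuallyEq (hT.tendsto_nhdsGT x) tendsto_const_nhds ?_)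
  filter_upwards [self_mem_nhdsWithin] with s hs using h0 hs

theorem contDiffOn_height {x : H} (hx : x ≠ 0) :
    ContDiffOn ℝ ∞ (height T x) (Set.Ioi 0) :=
  ContDiffOn.norm ℂ (fun _ ht => (hT.analyticAt x ht).contDiffAt.contDiffWithinAt)
    fun _ ht => hT.apply_ne_zero hx (le_of_lt ht)

end IsHolomorphicSemigroup

theorem hasDerivWithinAt_Ioi_iff_tendsto_smul_sub {v : ℝ → H} {v' : H} {t : ℝ} :
    HasDerivWithinAt v v' (Set.Ioi t) t ↔
      Tendsto (fun s : ℝ => ((s⁻¹ : ℝ) : ℂ) • (v (t + s) - v t)) (𝓝[>] 0) (𝓝 v') := by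
  rw [hasDerivWithinAt_iff_tendsto_slope' (by simp)]
  have : 𝓝[>] t = map (fun s => t + s) (𝓝[>] 0) := by
    simp [map_add_left_nhdsGT]
  rw [this, tendsto_map'_iff]
  refine tendsto_congr fun s => ?_
  simp [slope_def_module, ← Complex.coe_smul]

/-! ### Evolution equation and height function -/

namespace IsGenerator

variable {A : H →ₗ.[ℂ] H} {T : ℂ → H →L[ℂ] H}

theorem exists_apply_eq_iff (hA : IsGenerator (-A) T) {x y : H} :
    (∃ hx : x ∈ A.domain, A ⟨x, hx⟩ = y) ↔
      Tendsto (fun t : ℝ => ((t⁻¹ : ℝ) : ℂ) • (T (t : ℂ) x - x)) (𝓝[>] 0) (𝓝 (-y)) := by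
  rw [← hA x (-y)]
  refine exists_congr fun hx => ?_
  rw [LinearPMap.neg_apply, neg_inj]

/-- When the semigroup translates `v` forward from `t`, the quotient defining the generator at `v t`
is the right difference quotient of `v`. This serves for an orbit and again for its derivative. -/
theorem exists_apply_eq_neg_deriv (hA : IsGenerator (-A) T) {v : ℝ → H} {v' : H} {t : ℝ}
    (hv : HasDerivWithinAt v v' (Set.Ioi t) t) 
    (h : ∀ s : ℝ, 0 < s → T (s : ℂ) (v t) = v (t + s)) :
    ∃ hx : v t ∈ A.domain, A ⟨v t, hx⟩ = -v' := by
  rw [hA.exists_apply_eq_iff, neg_neg]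
  refine (hasDerivWithinAt_Ioi_iff_tendsto_smul_sub.1 hv).congr' ?_
  filter_upwards [self_mem_nhdsWithin] with s hs
  rw [h s hs]

variable {δ : ℝ} (hT : IsHolomorphicSemigroup δ T)
include hT

/-- On the domain of the generator, the right derivative of an orbit is the orbit of the
derivative at the origin. -/
theorem hasDerivWithinAt_Ici (hA : IsGenerator (-A) T) {x : H} (hx : x ∈ A.domain) {t : ℝ}
    (ht : 0 ≤ t) :
    HasDerivWithinAt (fun t : ℝ => T (t : ℂ) x) (T (t : ℂ) (-A ⟨x, hx⟩)) (Set.Ici t) t := by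
  rw [← hasDerivWithinAt_Ioi_iff_Ici, hasDerivWithinAt_Ioi_iff_tendsto_smul_sub]
  have h := ((T (t : ℂ)).continuous.tendsto _).comp (hA.exists_apply_eq_iff.1 ⟨hx, rfl⟩)
  refine h.congr' ?_
  filter_upwards [self_mem_nhdsWithin] with s hs
  simp only [Function.comp_apply, map_smul, map_sub]
  rw [hT.apply_add ht (le_of_lt hs)]

variable [CompleteSpace H]

/-- Positive-time orbits lie in the domain of the square of the generator and solve the evolution
equation twice. -/
theorem exists_derivs (hA : IsGenerator (-A) T) (x : H) {t : ℝ} (ht : 0 < t) :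
    ∃ (h₁ : T (t : ℂ) x ∈ A.domain) (h₂ : A ⟨T (t : ℂ) x, h₁⟩ ∈ A.domain),
      deriv (fun t : ℝ => T (t : ℂ) x) t = -A ⟨T (t : ℂ) x, h₁⟩ ∧
      deriv (deriv fun t : ℝ => T (t : ℂ) x) t = A ⟨A ⟨T (t : ℂ) x, h₁⟩, h₂⟩ := by
  set u : ℝ → H := fun t => T (t : ℂ) x with hu
  have hd : ∀ s, 0 < s → HasDerivAt u (deriv u s) s := fun s hs =>
    (hT.analyticAt x hs).differentiableAt.hasDerivAt
  have hd2 : HasDerivAt (deriv u) (deriv (deriv u) t) t :=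
    (hT.analyticAt x ht).deriv.differentiableAt.hasDerivAt
  obtain ⟨h₁, e₁⟩ := hA.exists_apply_eq_neg_deriv (hd t ht).hasDerivWithinAt fun s hs => by
    rw [hu, ← hT.apply_add hs.le ht.le, add_comm]
  -- Differentiate `T s (u r) = u (r + s)` in `r` at `t`.
  have hs' : ∀ s : ℝ, 0 < s → T (s : ℂ) (deriv u t) = deriv u (t + s) := by
    intro s hs
    have h3 : HasDerivAt (fun r => T (s : ℂ) (u r)) (T (s : ℂ) (deriv u t)) t :=
      ((T (s : ℂ)).restrictScalars ℝ).hasFDerivAt.comp_hasDerivAt t (hd t ht)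
    have h4 : HasDerivAt (fun r => u (r + s)) (deriv u (t + s)) t :=
      (hd (t + s) (by linarith)).comp_add_const t s
    refine h3.unique (h4.congr_of_eventuallyEq ?_)
    filter_upwards [lt_mem_nhds ht] with r hr
    rw [hu, ← hT.apply_add hs.le hr.le, add_comm]
  obtain ⟨h₂, e₂⟩ := hA.exists_apply_eq_neg_deriv hd2.hasDerivWithinAt hs'
  have h₃ : A ⟨u t, h₁⟩ ∈ A.domain := e₁ ▸ A.domain.neg_mem h₂
  refine ⟨h₁, h₃, by rw [e₁, neg_neg], ?_⟩
  have : (⟨A ⟨u t, h₁⟩, h₃⟩ : A.domain) = -⟨deriv u t, h₂⟩ := Subtype.ext e₁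
  rw [this, A.map_neg, e₂, neg_neg]

theorem hasDerivAt_height (hA : IsGenerator (-A) T) {x : H} (hx : x ≠ 0) {t : ℝ} (ht : 0 < t)
    (h : T (t : ℂ) x ∈ A.domain) :
    HasDerivAt (height T x)
      (-((inner ℂ (T (t : ℂ) x) (A ⟨T (t : ℂ) x, h⟩)).re / ‖T (t : ℂ) x‖)) t := by
  obtain ⟨h₁, -, e, -⟩ := hA.exists_derivs hT x ht
  have hd := (hT.analyticAt x ht).differentiableAt.hasDerivAt
  rw [e, ← hasDerivWithinAt_univ] at hd
  rw [← hasDerivWithinAt_univ]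
  have h2 := hd.norm_of_ne_zero (hT.apply_ne_zero hx ht.le)
  rwa [inner_neg_right, Complex.neg_re, neg_div] at h2

theorem convexOn_log_height (hA : IsGenerator (-A) T) (hc : LogConvexityCriterion A) {x : H}
    (hx : x ≠ 0) : ConvexOn ℝ (Set.Ici 0) fun t => Real.log (height T x t) := by
  refine convexOn_log_norm (hT.continuousOn x) (fun t ht => hT.apply_ne_zero hx ht)
    (fun t ht => (hT.analyticAt x ht).differentiableAt.hasDerivAt)
    (fun t ht => (hT.analyticAt x ht).deriv.differentiableAt.hasDerivAt) fun t ht => ?_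
  obtain ⟨h₁, h₂, e₁, e₂⟩ := hA.exists_derivs hT x ht
  rw [e₁, e₂, inner_neg_right, Complex.neg_re, neg_sq, norm_neg]
  exact hc.smul_norm h₁ h₂

theorem strictAntiOn_height (hA : IsGenerator (-A) T) (hc : IsPositivelyAccretive A) {x : H}
    (hx : x ≠ 0) : StrictAntiOn (height T x) (Set.Ici 0) := by
  refine strictAntiOn_of_deriv_neg (convex_Ici 0) (hT.continuousOn x).norm ?_
  rw [interior_Ici]
  intro t ht
  obtain ⟨h₁, -⟩ := hA.exists_derivs hT x ht
  rw [(hA.hasDerivAt_height hT hx ht h₁).deriv, neg_lt_zero]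
  exact div_pos (hc.re_inner_pos h₁ (hT.apply_ne_zero hx (le_of_lt ht)))
    (norm_pos_iff.2 (hT.apply_ne_zero hx (le_of_lt ht)))

theorem iInf_deriv_height_nonpos (hA : IsGenerator (-A) T) (hc : IsPositivelyAccretive A) {x : H}
    (hx : x ≠ 0) :
    ⨅ t : Set.Ioi (0 : ℝ), ((deriv (height T x) t : ℝ) : EReal) ≤ 0 := by
  refine (iInf_le _ (⟨1, Set.mem_Ioi.2 one_pos⟩ : Set.Ioi (0 : ℝ))).trans ?_
  obtain ⟨h₁, -⟩ := hA.exists_derivs hT x one_pos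
  rw [(hA.hasDerivAt_height hT hx one_pos h₁).deriv]
  refine EReal.coe_nonpos.2 (neg_nonpos.2 (div_nonneg ?_ (norm_nonneg _)))
  exact (hc.re_inner_pos h₁ (hT.apply_ne_zero hx zero_le_one)).le

/-- For every real `m < m(A)` the evolution equation gives `h' t ≤ -m * h t`, and `h t` tends to `1`
as `t → 0⁺`. -/
theorem iInf_deriv_height_le (hA : IsGenerator (-A) T) {x : H} (hx : ‖x‖ = 1) :
    ⨅ t : Set.Ioi (0 : ℝ), ((deriv (height T x) t : ℝ) : EReal) ≤ -lowerBound A := by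
  have hx0 : x ≠ 0 := norm_ne_zero_iff.1 (by rw [hx]; exact one_ne_zero)
  rw [EReal.le_neg]
  refine EReal.ge_of_forall_gt_iff_ge.1 fun m hm => ?_
  rw [EReal.le_neg, ← EReal.coe_neg]
  have hlim : Tendsto (fun t : ℝ => ((-(m * ‖T (t : ℂ) x‖) : ℝ) : EReal)) (𝓝[>] 0)
      (𝓝 ((-m : ℝ) : EReal)) := by
    have := ((hT.tendsto_nhdsGT x).norm.const_mul m).neg
    rw [hx, mul_one] at this
    exact (continuous_coe_real_ereal.tendsto _).comp this
  refine ge_of_tendsto hlim ?_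
  filter_upwards [self_mem_nhdsWithin] with t ht
  refine (iInf_le _ (⟨t, ht⟩ : Set.Ioi (0 : ℝ))).trans ?_
  obtain ⟨h₁, -⟩ := hA.exists_derivs hT x ht
  have h0 := hT.apply_ne_zero hx0 (le_of_lt ht)
  rw [(hA.hasDerivAt_height hT hx0 ht h₁).deriv, EReal.coe_le_coe_iff, neg_le_neg_iff,
    le_div_iff₀ (norm_pos_iff.2 h0), mul_assoc, ← sq]
  exact lowerBound_mul_sq_le h₁ h0 hm.le

theorem hasDerivWithinAt_height_zero (hA : IsGenerator (-A) T) {x : H} (hx : x ∈ A.domain)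
    (hx1 : ‖x‖ = 1) :
    HasDerivWithinAt (height T x) (-(inner ℂ x (A ⟨x, hx⟩)).re) (Set.Ici 0) 0 := by
  have hx0 : x ≠ 0 := norm_ne_zero_iff.1 (by rw [hx1]; exact one_ne_zero)
  have h := (hA.hasDerivWithinAt_Ici hT hx le_rfl).norm_of_ne_zero
    (hT.apply_ne_zero hx0 le_rfl)
  simp only [Complex.ofReal_zero, hT.map_zero, ContinuousLinearMap.id_apply, hx1, div_one,
    inner_neg_right, Complex.neg_re] at h
  exact h

/-- For `x` in `D(A)` the derivative of the orbit is the orbit of `-A x`, which is continuous up to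
`0`. -/
theorem contDiffOn_height_Ici (hA : IsGenerator (-A) T) {x : H} (hx : x ∈ A.domain)
    (hx0 : x ≠ 0) : ContDiffOn ℝ 1 (height T x) (Set.Ici 0) := by
  refine ContDiffOn.norm ℂ ?_ fun t ht => hT.apply_ne_zero hx0 ht
  have hd : ∀ t ∈ Set.Ici (0 : ℝ), HasDerivWithinAt (fun t : ℝ => T (t : ℂ) x)
      (T (t : ℂ) (-A ⟨x, hx⟩)) (Set.Ici 0) t := by
    intro t ht
    rcases (Set.mem_Ici.1 ht).eq_or_lt with rfl | ht
    · exact hA.hasDerivWithinAt_Ici hT hx le_rfl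
    · have h1 := (hT.analyticAt x ht).differentiableAt.hasDerivAt
      -- At `t > 0` the two-sided derivative exists by analyticity, so the right derivative
      -- identifies it.
      have h2 := (uniqueDiffWithinAt_Ici t).eq_deriv _ h1.hasDerivWithinAt
        (hA.hasDerivWithinAt_Ici hT hx ht.le)
      exact h2 ▸ h1.hasDerivWithinAt
  rw [contDiffOn_one_iff_derivWithin (uniqueDiffOn_Ici 0)]
  refine ⟨fun t ht => (hd t ht).differentiableWithinAt, ?_⟩
  exact (hT.continuousOn (-A ⟨x, hx⟩)).congr fun t ht =>
    (hd t ht).derivWithin (uniqueDiffOn_Ici 0 t ht)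

end IsGenerator

end HolSemigroup

theorem corollary2 {H : Type*} [NormedAddCommGroup H] [InnerProductSpace ℂ H] [CompleteSpace H]
    (A : H →ₗ.[ℂ] H) (δ : ℝ) (T : ℂ → H →L[ℂ] H)
    (hT : HolSemigroup.IsHolomorphicSemigroup δ T)
    (hgen : HolSemigroup.IsGenerator (-A) T)
    (hacc : HolSemigroup.IsPositivelyAccretive A)
    (hhyp : HolSemigroup.IsHyponormal A) :
    HolSemigroup.LogConvexityCriterion A ∧
    ∀ u₀ : H, u₀ ≠ 0 →
      HolSemigroup.IsLogConvex (HolSemigroup.height T u₀) ∧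
      StrictAntiOn (HolSemigroup.height T u₀) (Set.Ici 0) ∧
      StrictConvexOn ℝ (Set.Ici 0) (HolSemigroup.height T u₀) ∧
      ContDiffOn ℝ ∞ (HolSemigroup.height T u₀) (Set.Ioi 0) ∧
      (∃ d : EReal, d ≤ 0 ∧
        HolSemigroup.HasExtendedRightDerivAtZero (HolSemigroup.height T u₀) d ∧
        d = ⨅ t : Set.Ioi (0 : ℝ), ((deriv (HolSemigroup.height T u₀) t : ℝ) : EReal) ∧
        (‖u₀‖ = 1 → d ≤ -HolSemigroup.lowerBound A)) ∧
      (∀ hu : u₀ ∈ A.domain, ‖u₀‖ = 1 →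
        HasDerivWithinAt (HolSemigroup.height T u₀) (-(inner ℂ u₀ (A ⟨u₀, hu⟩)).re)
          (Set.Ici 0) 0 ∧
        ContDiffOn ℝ 1 (HolSemigroup.height T u₀) (Set.Ici 0)) := by
  have hcrit := hhyp.logConvexityCriterion
  refine ⟨hcrit, fun u₀ hu₀ => ?_⟩
  have hpos : ∀ t, 0 ≤ t → 0 < HolSemigroup.height T u₀ t := fun t ht =>
    norm_pos_iff.2 (hT.apply_ne_zero hu₀ ht)
  have hlog := hgen.convexOn_log_height hT hcrit hu₀
  have hanti := hgen.strictAntiOn_height hT hacc hu₀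
  have hconv := HolSemigroup.strictConvexOn_of_convexOn_log hpos hanti.injOn hlog
  have hsmooth := hT.contDiffOn_height hu₀
  refine ⟨HolSemigroup.isLogConvex_of_convexOn_log hpos hlog, hanti, hconv, hsmooth,
    ⟨_, hgen.iInf_deriv_height_nonpos hT hacc hu₀,
      HolSemigroup.hasExtendedRightDerivAtZero_iInf_deriv hconv.convexOn
        (hT.continuousOn u₀).norm fun t ht =>
          (hsmooth.contDiffAt (Ioi_mem_nhds ht)).differentiableAt (by simp),
      rfl, fun h1 => hgen.iInf_deriv_height_le hT h1⟩,
    fun hu h1 => ⟨hgen.hasDerivWithinAt_height_zero hT hu h1,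
      hgen.contDiffOn_height_Ici hT hu hu₀⟩⟩
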